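/- Let $n\ge 0$ be an integer, let $\|\cdot\|$ be the Euclidean norm on $\mathbb{R}^n$ (and the induced operator norm on the space $M_n(\mathbb{R})$ of real $n\times n$ matrices), and let $S^{n-1}=\{x\in\mathbb{R}^n : \|x\|=1\}$. For a bounded set $\mathscr{M}\subset M_n(\mathbb{R})$ consider the linear switched system $$(\Sigma_{\mathscr{M}})\qquad \dot x(t)=A(t)x(t),\quad t\ge 0,$$ where the switching law $A$ is an arbitrary measurable function from $[0,\infty)$ to $\mathscr{M}$. Its trajectories are the functions $x:[0,\infty)\to\mathbb{R}^n$ that are absolutely continuous on bounded intervals and satisfy the equation for almost every $t$, for some switching law $A$. Let $\Phi_A(\cdot,0)$ be the fundamental matrix, that is, the solution of $\dot\Phi(t)=A(t)\Phi(t)$, $\Phi(0)=\mathrm{Id}_n$. The system $(\Sigma_{\mathscr{M}})$ is *uniformly exponentially stable* if there exist $C,\gamma>0$ such that $\|\Phi_A(t,0)\|\le Ce^{-\gamma t}$ for every switching law $A$ and every $t\ge 0$. A *common Lyapunov function* for $(\Sigma_{\mathscr{M}})$ is a continuous function $V:\mathbb{R}^n\to[0,\infty)$ with $V(0)=0$ and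 $V(x)>0$ for $x\ne 0$ that is non-increasing along every trajectory of $(\Sigma_{\mathscr{M}})$ and strictly decreasing along every trajectory that is not identically zero. A set $\mathcal{P}$ of functions from $\mathbb{R}^n$ to $\mathbb{R}$ is a *universal class of Lyapunov functions* if, for every bounded set $\mathscr{M}\subset M_n(\mathbb{R})$ such that $(\Sigma_{\mathscr{M}})$ is uniformly exponentially stable, $\mathcal{P}$ contains a common Lyapunov function for $(\Sigma_{\mathscr{M}})$. A function $V:\mathbb{R}^n\to\mathbb{R}$ is *absolutely homogeneous of degree one* if $V(\lambda x)=|\lambda|V(x)$ for all $x\in\mathbb{R}^n$ and $\lambda\in\mathbb{R}$. **Proposition.** Let $\mathcal{P}$ be a subset of the family of convex functions from $\mathbb{R}^n$ to $[0,\infty)$ that are absolutely homogeneous of degree one. Assume that for every convex function $V:\mathbb{R}^n\to[0,\infty)$ that is absolutely homogeneous of degree one and every $\delta>0$ there exists $W\in\mathcal{P}$ such that $|W(x)-V(x)|\le\delta$ for every $x\in S^{n-1}$. Then $\mathcal{P}$ is a universal class of Lyapunov functions. -/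

import Mathlib

open MeasureTheory Set
open scoped Matrix.Norms.L2Operator

namespace SwitchedSystem

/-- A solution on `[s, ∞)`, in the sense of Carathéodory, of the differential equation
`y'(t) = F t (y t)`: `y` is absolutely continuous on every interval `[s, T]` and satisfies the
equation at almost every time `t > s`. The values of `y` at times before `s` are irrelevant. -/
def IsSolution {E : Type*} [NormedAddCommGroup E] [NormedSpace ℝ E]
    (F : ℝ → E → E) (s : ℝ) (y : ℝ → E) : Prop :=
  (∀ T : ℝ, s ≤ T → AbsolutelyContinuousOnInterval y s T) ∧
    ∀ᵐ t ∂(volume : Measure ℝ), s < t → HasDerivAt y (F t (y t)) t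

/-- The switching laws of the system with set of modes `𝓜`: the (entrywise Lebesgue) measurable
functions from `[0, ∞)` to `𝓜`. The values at negative times are irrelevant. -/
def switchingLaws {n : ℕ} (𝓜 : Set (Matrix (Fin n) (Fin n) ℝ)) :
    Set (ℝ → Matrix (Fin n) (Fin n) ℝ) :=
  {A | (∀ i j, AEMeasurable (fun t => A t i j) (volume.restrict (Ici 0))) ∧ ∀ t : ℝ, 0 ≤ t → A t ∈ 𝓜}

/-- `x` is a trajectory of `x'(t) = A(t) x(t)`, `t ≥ 0`. -/
def IsTrajectory {n : ℕ} (A : ℝ → Matrix (Fin n) (Fin n) ℝ)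
    (x : ℝ → EuclideanSpace ℝ (Fin n)) : Prop :=
  IsSolution (fun t v => Matrix.toEuclideanLin (A t) v) 0 x

/-- `Φ` is the fundamental matrix `t ↦ Φ_A(t, s)`, `t ≥ s`, of `x'(t) = A(t) x(t)`: the
solution of the matrix equation `Φ'(t) = A(t) Φ(t)` with `Φ(s) = Id`. -/
def IsFundamentalMatrix {n : ℕ} (A : ℝ → Matrix (Fin n) (Fin n) ℝ) (s : ℝ)
    (Φ : ℝ → Matrix (Fin n) (Fin n) ℝ) : Prop :=
  Φ s = 1 ∧ IsSolution (fun t X => A t * X) s Φ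

/-- Uniform exponential stability: `‖Φ_A(t, 0)‖ ≤ C e^{-γ t}` with `C, γ > 0` independent of the
switching law `A` and of `t ≥ 0`. The norm is the operator norm for the Euclidean norm. -/
def UniformlyExponentiallyStable {n : ℕ} (𝓜 : Set (Matrix (Fin n) (Fin n) ℝ)) : Prop :=
  ∃ C γ : ℝ, 0 < C ∧ 0 < γ ∧ ∀ A ∈ switchingLaws 𝓜, ∀ Φ : ℝ → Matrix (Fin n) (Fin n) ℝ,
    IsFundamentalMatrix A 0 Φ → ∀ t : ℝ, 0 ≤ t → ‖Φ t‖ ≤ C * Real.exp (-γ * t)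

/-- A nonstrict common Lyapunov function. -/
structure IsNonstrictCommonLyapunov {n : ℕ} (𝓜 : Set (Matrix (Fin n) (Fin n) ℝ))
    (V : EuclideanSpace ℝ (Fin n) → ℝ) : Prop where
  continuous : Continuous V
  zero : V 0 = 0
  pos : ∀ x, x ≠ 0 → 0 < V x
  antitone : ∀ A ∈ switchingLaws 𝓜, ∀ x : ℝ → EuclideanSpace ℝ (Fin n), IsTrajectory A x →
    AntitoneOn (fun t => V (x t)) (Ici 0)

/-- A (strict) common Lyapunov function: it is moreover strictly decreasing along every
trajectory that is not identically zero on `[0, ∞)`. -/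
structure IsCommonLyapunov {n : ℕ} (𝓜 : Set (Matrix (Fin n) (Fin n) ℝ))
    (V : EuclideanSpace ℝ (Fin n) → ℝ) : Prop extends IsNonstrictCommonLyapunov 𝓜 V where
  strictAnti : ∀ A ∈ switchingLaws 𝓜, ∀ x : ℝ → EuclideanSpace ℝ (Fin n), IsTrajectory A x →
    (∃ t : ℝ, 0 ≤ t ∧ x t ≠ 0) → StrictAntiOn (fun t => V (x t)) (Ici 0)

/-- A set of functions is a universal class of Lyapunov functions if it contains a (strict) common
Lyapunov function for every uniformly exponentially stable system with bounded set of modes. -/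
def IsUniversalClass {n : ℕ} (P : Set (EuclideanSpace ℝ (Fin n) → ℝ)) : Prop :=
  ∀ 𝓜 : Set (Matrix (Fin n) (Fin n) ℝ), Bornology.IsBounded 𝓜 →
    UniformlyExponentiallyStable 𝓜 → ∃ V ∈ P, IsCommonLyapunov 𝓜 V

/-- Absolute homogeneity of degree `α`. -/
def AbsolutelyHomogeneous {n : ℕ} (α : ℝ) (V : EuclideanSpace ℝ (Fin n) → ℝ) : Prop :=
  ∀ (c : ℝ) (x : EuclideanSpace ℝ (Fin n)), V (c • x) = |c| ^ α * V x

/-- The convex, absolutely homogeneous functions of degree one from `ℝⁿ` to `[0, ∞)`. -/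
def convexHomogeneous (n : ℕ) : Set (EuclideanSpace ℝ (Fin n) → ℝ) :=
  {V | ConvexOn ℝ univ V ∧ AbsolutelyHomogeneous 1 V ∧ ∀ x, 0 ≤ V x}

end SwitchedSystem

namespace SwitchedSystem

open Filter Topology

/-! The supremum `V x` of `e^{γt} ‖Φ_A(t,0) x‖` is a norm with `‖x‖ ≤ V x ≤ C ‖x‖`, and it contracts
by `e^{-γh}` under `e^{hB}`, `B ∈ 𝓜` (`weightedSup_exp_le`). Laws with locally Lipschitz fundamental
matrices suffice: they only need to be closed under prepending a constant mode.

For one fixed small `h`, `V` then also contracts under the Euler step `x ↦ x + hBx`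
(`exists_contracted_by_euler_step`). Unlike a condition on derivatives, this survives uniform
approximation on the sphere, so a close enough `W ∈ P` inherits it. Convexity spreads the
contraction of `W` to all steps `s ≤ h` (`convexHomogeneous.euler_step_le`); this bounds the
derivative of `W` along trajectories, and Grönwall gives exponential decay. -/

theorem norm_toEuclideanLin_le {n : ℕ} (A : Matrix (Fin n) (Fin n) ℝ)
    (x : EuclideanSpace ℝ (Fin n)) : ‖Matrix.toEuclideanLin A x‖ ≤ ‖A‖ * ‖x‖ :=
  Matrix.l2_opNorm_mulVec A x

theorem toEuclideanLin_mul_apply {n : ℕ} (A B : Matrix (Fin n) (Fin n) ℝ)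
    (x : EuclideanSpace ℝ (Fin n)) :
    Matrix.toEuclideanLin (A * B) x = Matrix.toEuclideanLin A (Matrix.toEuclideanLin B x) := by
  ext i
  simp [Matrix.mulVec_mulVec]

theorem toEuclideanLin_one_apply {n : ℕ} (x : EuclideanSpace ℝ (Fin n)) :
    Matrix.toEuclideanLin (1 : Matrix (Fin n) (Fin n) ℝ) x = x := by
  ext i
  simp

theorem _root_.LocallyLipschitz.absolutelyContinuousOnInterval {X : Type*} [PseudoMetricSpace X]
    {f : ℝ → X} (hf : LocallyLipschitz f) (a b : ℝ) : AbsolutelyContinuousOnInterval f a b := by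
  obtain ⟨K, hK⟩ := (hf.locallyLipschitzOn (s := uIcc a b)).exists_lipschitzOnWith_of_compact
    isCompact_uIcc
  exact hK.absolutelyContinuousOnInterval

theorem locallyLipschitz_exp_smul {𝔸 : Type*} [NormedRing 𝔸] [NormedAlgebra ℝ 𝔸] [CompleteSpace 𝔸]
    (B : 𝔸) : LocallyLipschitz (fun t : ℝ => NormedSpace.exp (t • B)) := by
  refine ContDiff.locallyLipschitz (𝕂 := ℝ) ?_
  have hexp : ContDiff ℝ 1 (NormedSpace.exp : 𝔸 → 𝔸) :=
    contDiff_iff_contDiffAt.2 fun x => (NormedSpace.exp_analytic (𝕂 := ℝ) x).contDiffAt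
  exact hexp.comp (contDiff_id.smul contDiff_const)

theorem _root_.LocallyLipschitz.mul_of_normedAlgebra {X 𝔸 : Type*} [PseudoEMetricSpace X]
    [NormedRing 𝔸] [NormedAlgebra ℝ 𝔸] {f g : X → 𝔸} (hf : LocallyLipschitz f)
    (hg : LocallyLipschitz g) : LocallyLipschitz (fun x => f x * g x) :=
  (ContDiff.locallyLipschitz (𝕂 := ℝ) (contDiff_fst.mul contDiff_snd :
    ContDiff ℝ 1 fun p : 𝔸 × 𝔸 => p.1 * p.2)).comp (hf.prodMk hg)

/-! ### Transitions of regular switching laws -/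

/-- The pairs `(t, Φ_A(t, 0))`, where `A` is an entrywise Borel measurable switching law with a
locally Lipschitz fundamental matrix. -/
def regularTransitions {n : ℕ} (𝓜 : Set (Matrix (Fin n) (Fin n) ℝ)) :
    Set (ℝ × Matrix (Fin n) (Fin n) ℝ) :=
  {p | ∃ A Φ : ℝ → Matrix (Fin n) (Fin n) ℝ, (∀ i j, Measurable fun t => A t i j) ∧
    (∀ t, 0 ≤ t → A t ∈ 𝓜) ∧ LocallyLipschitz Φ ∧ Φ 0 = 1 ∧
    (∀ᵐ t ∂(volume : Measure ℝ), 0 < t → HasDerivAt Φ (A t * Φ t) t) ∧ 0 ≤ p.1 ∧ Φ p.1 = p.2}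

variable {n : ℕ} {𝓜 : Set (Matrix (Fin n) (Fin n) ℝ)}

theorem zero_one_mem_regularTransitions (h𝓜 : 𝓜.Nonempty) :
    ((0 : ℝ), (1 : Matrix (Fin n) (Fin n) ℝ)) ∈ regularTransitions 𝓜 := by
  obtain ⟨B, hB⟩ := h𝓜
  refine ⟨fun _ => B, fun t => NormedSpace.exp (t • B), fun i j => measurable_const,
    fun _ _ => hB, locallyLipschitz_exp_smul B, by simp, ae_of_all _ fun t _ => ?_, le_rfl,
    by simp⟩
  exact hasDerivAt_exp_smul_const' B t

/-- Run the mode `B` for time `h`, then the law of `p` delayed by `h`; the earlier phase is the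
right factor. -/
theorem mul_exp_mem_regularTransitions {p : ℝ × Matrix (Fin n) (Fin n) ℝ}
    (hp : p ∈ regularTransitions 𝓜) {B : Matrix (Fin n) (Fin n) ℝ} (hB : B ∈ 𝓜) {h : ℝ}
    (hh : 0 ≤ h) : (p.1 + h, p.2 * NormedSpace.exp (h • B)) ∈ regularTransitions 𝓜 := by
  obtain ⟨A, Φ, hAm, hA, hΦ, hΦ0, hd, ht, hpΦ⟩ := hp
  refine ⟨fun t => if t < h then B else A (t - h),
    -- Clamping both times gives one formula for the two phases, visibly locally Lipschitz across `t
    -- = h`.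
    fun t => Φ (max (t - h) 0) * NormedSpace.exp ((min t h) • B), ?_, ?_, ?_, ?_, ?_, ?_, ?_⟩
  · intro i j
    have : (fun t => (if t < h then B else A (t - h)) i j) =
        fun t => if t < h then B i j else A (t - h) i j := by
      funext t; split_ifs <;> rfl
    rw [this]
    exact Measurable.ite measurableSet_Iio measurable_const
      ((hAm i j).comp (measurable_id.sub_const h))
  · intro t _
    dsimp only
    split_ifs with hth
    · exact hB
    · exact hA _ (by linarith)
  · refine LocallyLipschitz.mul_of_normedAlgebra ?_ ?_
    · refine hΦ.comp (LipschitzWith.locallyLipschitz (K := 1) ?_)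
      exact LipschitzWith.max_const (by simpa using LipschitzWith.id.sub (LipschitzWith.const h)) 0
    · exact (locallyLipschitz_exp_smul B).comp
        (LipschitzWith.id.min_const h).locallyLipschitz
  · simp [hh, hΦ0]
  · have hshift : ∀ᵐ t ∂(volume : Measure ℝ), 0 < t - h →
        HasDerivAt Φ (A (t - h) * Φ (t - h)) (t - h) :=
      (measurePreserving_sub_right volume h).quasiMeasurePreserving.ae hd
    have hne : ∀ᵐ t ∂(volume : Measure ℝ), t ≠ h := Measure.ae_ne volume h
    filter_upwards [hshift, hne] with t hts hth _
    rcases lt_or_gt_of_ne hth with hlt | hgt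
    · have hev : (fun t => Φ (max (t - h) 0) * NormedSpace.exp ((min t h) • B)) =ᶠ[𝓝 t]
          fun t => NormedSpace.exp (t • B) := by
        filter_upwards [Iio_mem_nhds hlt] with s hs
        rw [max_eq_right (by linarith [mem_Iio.1 hs]), min_eq_left (mem_Iio.1 hs).le, hΦ0, one_mul]
      have := (hasDerivAt_exp_smul_const' B t).congr_of_eventuallyEq hev
      simpa [hlt, hlt.le, hΦ0] using this
    · have hev : (fun t => Φ (max (t - h) 0) * NormedSpace.exp ((min t h) • B)) =ᶠ[𝓝 t]
          fun t => Φ (t - h) * NormedSpace.exp (h • B) := by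
        filter_upwards [Ioi_mem_nhds hgt] with s hs
        rw [max_eq_left (by linarith [mem_Ioi.1 hs]), min_eq_right (mem_Ioi.1 hs).le]
      have h1 := ((hts (by linarith)).comp_sub_const t h).mul_const (NormedSpace.exp (h • B))
      have := h1.congr_of_eventuallyEq hev
      simpa [hgt.le, hgt.not_gt, mul_assoc] using this
  · dsimp only; linarith
  · simp [ht, hpΦ]

theorem UniformlyExponentiallyStable.regularTransitions_norm_le
    (hs : UniformlyExponentiallyStable 𝓜) : ∃ C γ : ℝ, 0 < C ∧ 0 < γ ∧
      ∀ p ∈ regularTransitions 𝓜, ‖p.2‖ ≤ C * Real.exp (-γ * p.1) := by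
  obtain ⟨C, γ, hC, hγ, h⟩ := hs
  refine ⟨C, γ, hC, hγ, ?_⟩
  rintro p ⟨A, Φ, hAm, hA, hΦ, hΦ0, hd, ht, hp⟩
  rw [← hp]
  exact h A ⟨fun i j => (hAm i j).aemeasurable, hA⟩ Φ
    ⟨hΦ0, fun T _ => hΦ.absolutelyContinuousOnInterval 0 T, hd⟩ p.1 ht

/-! ### The exponentially weighted norm -/

/-- The weighted supremum of the norms of the images of a vector under a set of transitions. -/
noncomputable def weightedSup (S : Set (ℝ × Matrix (Fin n) (Fin n) ℝ)) (γ : ℝ)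
    (x : EuclideanSpace ℝ (Fin n)) : ℝ :=
  ⨆ p : S, Real.exp (γ * p.1.1) * ‖Matrix.toEuclideanLin p.1.2 x‖

section weightedSup

variable {S : Set (ℝ × Matrix (Fin n) (Fin n) ℝ)} {C γ : ℝ}

theorem weight_mul_norm_le (hS : ∀ p ∈ S, ‖p.2‖ ≤ C * Real.exp (-γ * p.1)) (p : S)
    (x : EuclideanSpace ℝ (Fin n)) :
    Real.exp (γ * p.1.1) * ‖Matrix.toEuclideanLin p.1.2 x‖ ≤ C * ‖x‖ := by
  calc Real.exp (γ * p.1.1) * ‖Matrix.toEuclideanLin p.1.2 x‖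
      ≤ Real.exp (γ * p.1.1) * ((C * Real.exp (-γ * p.1.1)) * ‖x‖) := by
        gcongr
        exact (norm_toEuclideanLin_le _ _).trans (by gcongr; exact hS p.1 p.2)
    _ = (Real.exp (γ * p.1.1) * Real.exp (-γ * p.1.1)) * (C * ‖x‖) := by ring
    _ = C * ‖x‖ := by rw [← Real.exp_add]; simp

theorem weight_mul_norm_le_weightedSup (hS : ∀ p ∈ S, ‖p.2‖ ≤ C * Real.exp (-γ * p.1)) (p : S)
    (x : EuclideanSpace ℝ (Fin n)) :
    Real.exp (γ * p.1.1) * ‖Matrix.toEuclideanLin p.1.2 x‖ ≤ weightedSup S γ x :=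
  le_ciSup (f := fun p : S => Real.exp (γ * p.1.1) * ‖Matrix.toEuclideanLin p.1.2 x‖)
    ⟨C * ‖x‖, by rintro _ ⟨p, rfl⟩; exact weight_mul_norm_le hS p x⟩ p

theorem weightedSup_nonneg (x : EuclideanSpace ℝ (Fin n)) : 0 ≤ weightedSup S γ x :=
  Real.iSup_nonneg fun _ => by positivity

theorem weightedSup_smul (c : ℝ) (x : EuclideanSpace ℝ (Fin n)) :
    weightedSup S γ (c • x) = |c| * weightedSup S γ x := by
  rw [weightedSup, weightedSup, Real.mul_iSup_of_nonneg (abs_nonneg c)]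
  congr 1
  funext p
  rw [map_smul, norm_smul, Real.norm_eq_abs]
  ring

theorem weightedSup_le [Nonempty S] (hS : ∀ p ∈ S, ‖p.2‖ ≤ C * Real.exp (-γ * p.1))
    (x : EuclideanSpace ℝ (Fin n)) : weightedSup S γ x ≤ C * ‖x‖ :=
  ciSup_le fun p => weight_mul_norm_le hS p x

theorem weightedSup_add_le [Nonempty S] (hS : ∀ p ∈ S, ‖p.2‖ ≤ C * Real.exp (-γ * p.1))
    (x y : EuclideanSpace ℝ (Fin n)) :
    weightedSup S γ (x + y) ≤ weightedSup S γ x + weightedSup S γ y := by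
  refine ciSup_le fun p => ?_
  calc Real.exp (γ * p.1.1) * ‖Matrix.toEuclideanLin p.1.2 (x + y)‖
      ≤ Real.exp (γ * p.1.1) *
          (‖Matrix.toEuclideanLin p.1.2 x‖ + ‖Matrix.toEuclideanLin p.1.2 y‖) := by
        rw [map_add]; gcongr; exact norm_add_le _ _
    _ ≤ _ := by
        rw [mul_add]
        exact add_le_add (weight_mul_norm_le_weightedSup hS p x)
          (weight_mul_norm_le_weightedSup hS p y)

end weightedSup

theorem mem_convexHomogeneous_of_add_le {V : EuclideanSpace ℝ (Fin n) → ℝ}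
    (hadd : ∀ x y, V (x + y) ≤ V x + V y) (hsmul : ∀ (c : ℝ) x, V (c • x) = |c| * V x)
    (hnonneg : ∀ x, 0 ≤ V x) : V ∈ convexHomogeneous n := by
  refine ⟨⟨convex_univ, fun x _ y _ a b ha hb _ => ?_⟩, fun c x => by simp [hsmul], hnonneg⟩
  calc V (a • x + b • y) ≤ V (a • x) + V (b • y) := hadd _ _
    _ = a • V x + b • V y := by rw [hsmul, hsmul, abs_of_nonneg ha, abs_of_nonneg hb]; rfl

/-- A transition applied after `e^{hB}` is itself a transition, lasting `h` longer, so its weight in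
the supremum gains `e^{γh}`. -/
theorem weightedSup_exp_le {C γ h : ℝ}
    (hS : ∀ p ∈ regularTransitions 𝓜, ‖p.2‖ ≤ C * Real.exp (-γ * p.1)) (h𝓜 : 𝓜.Nonempty)
    {B : Matrix (Fin n) (Fin n) ℝ} (hB : B ∈ 𝓜) (hh : 0 ≤ h) (x : EuclideanSpace ℝ (Fin n)) :
    weightedSup (regularTransitions 𝓜) γ (Matrix.toEuclideanLin (NormedSpace.exp (h • B)) x) ≤
      Real.exp (-(γ * h)) * weightedSup (regularTransitions 𝓜) γ x := by
  have : Nonempty (regularTransitions 𝓜) := ⟨⟨_, zero_one_mem_regularTransitions h𝓜⟩⟩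
  refine ciSup_le fun p => ?_
  have h1 := weight_mul_norm_le_weightedSup hS
    ⟨_, mul_exp_mem_regularTransitions p.2 hB hh⟩ x
  rw [toEuclideanLin_mul_apply] at h1
  refine le_trans (le_of_eq ?_) (mul_le_mul_of_nonneg_left h1 (Real.exp_pos _).le)
  rw [← mul_assoc, ← Real.exp_add]
  congr 2
  ring

/-! ### From exponentials to Euler steps -/

theorem exists_norm_exp_smul_sub_le {K ε : ℝ} (hK : 0 < K) (hε : 0 < ε) :
    ∃ h₀ > 0, ∀ h : ℝ, 0 ≤ h → h < h₀ → ∀ B : Matrix (Fin n) (Fin n) ℝ, ‖B‖ ≤ K →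
      ‖NormedSpace.exp (h • B) - (1 + h • B)‖ ≤ ε * h := by
  have h0 := (hasFDerivAt_exp_zero (𝕂 := ℝ) (𝔸 := Matrix (Fin n) (Fin n) ℝ)).isLittleO
  have h1 := h0.def (c := ε / K) (by positivity)
  obtain ⟨r, hr, hball⟩ := Metric.eventually_nhds_iff.1 h1
  refine ⟨r / K, by positivity, fun h hh hlt B hB => ?_⟩
  have hn : ‖h • B‖ ≤ h * K := by
    rw [norm_smul, Real.norm_of_nonneg hh]; gcongr
  have h2 := @hball (h • B) (by
    rw [dist_zero_right]; exact hn.trans_lt ((lt_div_iff₀ hK).1 hlt))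
  simp only [NormedSpace.exp_zero, sub_zero, one_apply_eq_self] at h2
  rw [sub_sub] at h2
  refine h2.trans ?_
  calc ε / K * ‖h • B‖ ≤ ε / K * (h * K) := by gcongr
    _ = ε * h := by field_simp

/-- A stable bounded system has a convex homogeneous function, equivalent to the norm, that
contracts uniformly under Euler steps of some fixed length. -/
theorem exists_contracted_by_euler_step (hb : Bornology.IsBounded 𝓜)
    (hs : UniformlyExponentiallyStable 𝓜) :
    ∃ V ∈ convexHomogeneous n, ∃ M h η : ℝ, 0 < h ∧ 0 < η ∧ η ≤ 1 ∧
      (∀ x, ‖x‖ ≤ V x) ∧ (∀ x, V x ≤ M * ‖x‖) ∧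
      ∀ B ∈ 𝓜, ∀ x, V (x + h • Matrix.toEuclideanLin B x) ≤ (1 - 2 * η) * V x := by
  -- Without modes the supremum would be over the empty set, but the contraction is vacuous and the
  -- Euclidean norm serves.
  rcases 𝓜.eq_empty_or_nonempty with rfl | h𝓜
  · refine ⟨fun x => ‖x‖, mem_convexHomogeneous_of_add_le norm_add_le (fun c x => by
      rw [norm_smul, Real.norm_eq_abs]) norm_nonneg, 1, 1, 1, one_pos, one_pos, le_rfl,
      fun x => le_rfl, fun x => by simp, by simp⟩
  obtain ⟨K, hK, hbK⟩ := hb.exists_pos_norm_le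
  obtain ⟨C, γ, hC, hγ, hS⟩ := hs.regularTransitions_norm_le
  have : Nonempty (regularTransitions 𝓜) := ⟨⟨_, zero_one_mem_regularTransitions h𝓜⟩⟩
  obtain ⟨h₀, hh₀, hexp⟩ := exists_norm_exp_smul_sub_le (n := n) hK
    (show 0 < γ / (4 * C) by positivity)
  -- The first bound controls the Euler error; the second gives `γh ≤ 1`, hence `e^{-γh} ≤ 1 -
  -- γh/2`.
  set h := min (h₀ / 2) (1 / γ) with hh
  have hpos : 0 < h := by positivity
  have hlt : h < h₀ := (min_le_left _ _).trans_lt (by linarith)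
  have hγh : γ * h ≤ 1 := by
    calc γ * h ≤ γ * (1 / γ) := by gcongr; exact min_le_right _ _
      _ = 1 := by field_simp
  set V := weightedSup (regularTransitions 𝓜) γ with hV
  have hVnorm : ∀ x, ‖x‖ ≤ V x := fun x => by
    have := weight_mul_norm_le_weightedSup hS ⟨_, zero_one_mem_regularTransitions h𝓜⟩ x
    simpa [toEuclideanLin_one_apply] using this
  have hγh0 : 0 < γ * h := by positivity
  -- The gain `γh/2` less the Euler error `γh/4` leaves `γh/4 = 2η`.
  refine ⟨V, mem_convexHomogeneous_of_add_le (weightedSup_add_le hS) weightedSup_smul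
    weightedSup_nonneg, C, h, γ * h / 8, hpos, by positivity, by linarith, hVnorm,
    weightedSup_le hS, fun B hB x => ?_⟩
  have hsplit : x + h • Matrix.toEuclideanLin B x =
      Matrix.toEuclideanLin (NormedSpace.exp (h • B)) x +
        (-1 : ℝ) • Matrix.toEuclideanLin (NormedSpace.exp (h • B) - (1 + h • B)) x := by
    simp only [map_sub, map_add, map_smul, LinearMap.sub_apply, LinearMap.add_apply,
      LinearMap.smul_apply, toEuclideanLin_one_apply]
    module
  have hrem : V (Matrix.toEuclideanLin (NormedSpace.exp (h • B) - (1 + h • B)) x) ≤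
      γ * h / 4 * V x := by
    calc V (Matrix.toEuclideanLin (NormedSpace.exp (h • B) - (1 + h • B)) x)
        ≤ C * ‖Matrix.toEuclideanLin (NormedSpace.exp (h • B) - (1 + h • B)) x‖ :=
          weightedSup_le hS _
      _ ≤ C * (γ / (4 * C) * h * V x) := by
          gcongr
          refine (norm_toEuclideanLin_le _ _).trans ?_
          gcongr
          · exact hexp h hpos.le hlt B (hbK B hB)
          · exact hVnorm x
      _ = γ * h / 4 * V x := by field_simp
  have hexp' : Real.exp (-(γ * h)) ≤ 1 - γ * h / 2 := by
    have h1 : Real.exp (-(γ * h)) ≤ (1 + γ * h)⁻¹ := by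
      rw [Real.exp_neg]
      gcongr
      linarith [Real.add_one_le_exp (γ * h)]
    refine h1.trans ?_
    rw [inv_le_iff_one_le_mul₀ (by positivity)]
    nlinarith
  have hVx : 0 ≤ V x := weightedSup_nonneg x
  calc V (x + h • Matrix.toEuclideanLin B x)
      ≤ V (Matrix.toEuclideanLin (NormedSpace.exp (h • B)) x) +
        V ((-1 : ℝ) • Matrix.toEuclideanLin (NormedSpace.exp (h • B) - (1 + h • B)) x) := by
        rw [hsplit]; exact weightedSup_add_le hS _ _
    _ ≤ (1 - γ * h / 2) * V x + γ * h / 4 * V x := by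
        refine add_le_add ((weightedSup_exp_le hS h𝓜 hB hpos.le x).trans (by gcongr)) ?_
        rw [hV, weightedSup_smul, abs_neg, abs_one, one_mul]
        exact hrem
    _ = (1 - 2 * (γ * h / 8)) * V x := by ring

/-! ### Convex homogeneous functions -/

theorem convexHomogeneous.map_smul {W : EuclideanSpace ℝ (Fin n) → ℝ}
    (hW : W ∈ convexHomogeneous n) (c : ℝ) (x : EuclideanSpace ℝ (Fin n)) :
    W (c • x) = |c| * W x := by
  rw [hW.2.1, Real.rpow_one]

theorem convexHomogeneous.map_zero {W : EuclideanSpace ℝ (Fin n) → ℝ}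
    (hW : W ∈ convexHomogeneous n) : W 0 = 0 := by
  simpa using convexHomogeneous.map_smul hW 0 0

theorem convexHomogeneous.add_le {W : EuclideanSpace ℝ (Fin n) → ℝ}
    (hW : W ∈ convexHomogeneous n) (x y : EuclideanSpace ℝ (Fin n)) : W (x + y) ≤ W x + W y := by
  have h := hW.1.2 (mem_univ ((2 : ℝ) • x)) (mem_univ ((2 : ℝ) • y))
    (by norm_num : (0 : ℝ) ≤ 1 / 2) (by norm_num : (0 : ℝ) ≤ 1 / 2) (by norm_num)
  rw [convexHomogeneous.map_smul hW, convexHomogeneous.map_smul hW, smul_smul, smul_smul] at h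
  norm_num at h
  linarith

theorem convexHomogeneous.abs_sub_le {W : EuclideanSpace ℝ (Fin n) → ℝ}
    (hW : W ∈ convexHomogeneous n) (x y : EuclideanSpace ℝ (Fin n)) :
    |W x - W y| ≤ W (x - y) := by
  have h1 := convexHomogeneous.add_le hW (x - y) y
  have h2 := convexHomogeneous.add_le hW (y - x) x
  have h3 := convexHomogeneous.map_smul hW (-1) (x - y)
  simp only [neg_smul, one_smul, neg_sub, abs_neg, abs_one, one_mul] at h3
  rw [sub_add_cancel] at h1 h2
  rw [abs_le]
  constructor <;> linarith

theorem convexHomogeneous.abs_sub_le_mul_norm {W V : EuclideanSpace ℝ (Fin n) → ℝ}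
    (hW : W ∈ convexHomogeneous n) (hV : V ∈ convexHomogeneous n) {δ : ℝ}
    (h : ∀ x ∈ Metric.sphere (0 : EuclideanSpace ℝ (Fin n)) 1, |W x - V x| ≤ δ)
    (x : EuclideanSpace ℝ (Fin n)) : |W x - V x| ≤ δ * ‖x‖ := by
  rcases eq_or_ne x 0 with rfl | hx
  · simp [convexHomogeneous.map_zero hW, convexHomogeneous.map_zero hV]
  have hx' : 0 < ‖x‖ := norm_pos_iff.2 hx
  have h1 := h (‖x‖⁻¹ • x) (by simp [norm_smul, hx'.ne'])
  rw [convexHomogeneous.map_smul hW, convexHomogeneous.map_smul hV, ← mul_sub, abs_mul, abs_abs,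
    abs_of_pos (inv_pos.2 hx'), inv_mul_le_iff₀ hx'] at h1
  linarith

/-- The point `x + s • v` is a convex combination of `x` and `x + h • v`. -/
theorem convexHomogeneous.euler_step_le {W : EuclideanSpace ℝ (Fin n) → ℝ}
    (hW : W ∈ convexHomogeneous n) {x v : EuclideanSpace ℝ (Fin n)} {h η s : ℝ} (hh : 0 < h)
    (hstep : W (x + h • v) ≤ (1 - η) * W x) (hs : 0 ≤ s) (hsh : s ≤ h) :
    W (x + s • v) ≤ W x - s * (η / h * W x) := by
  have hconv := hW.1.2 (mem_univ x) (mem_univ (x + h • v))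
    (sub_nonneg.2 ((div_le_one hh).2 hsh)) (div_nonneg hs hh.le) (sub_add_cancel 1 (s / h))
  have hpt : (1 - s / h) • x + (s / h) • (x + h • v) = x + s • v := by
    rw [smul_add, smul_smul, div_mul_cancel₀ _ hh.ne', sub_smul, one_smul]
    abel
  rw [hpt, smul_eq_mul, smul_eq_mul] at hconv
  refine hconv.trans ?_
  calc (1 - s / h) * W x + s / h * W (x + h • v)
      ≤ (1 - s / h) * W x + s / h * ((1 - η) * W x) := by gcongr
    _ = W x - s * (η / h * W x) := by ring

/-! ### Differential inequalities along absolutely continuous curves -/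

theorem _root_.AbsolutelyContinuousOnInterval.of_dist_le {X Y : Type*} [PseudoMetricSpace X]
    [PseudoMetricSpace Y] {f : ℝ → X} {g : ℝ → Y} {a b M : ℝ}
    (hf : AbsolutelyContinuousOnInterval f a b)
    (h : ∀ s t, dist (g s) (g t) ≤ M * dist (f s) (f t)) :
    AbsolutelyContinuousOnInterval g a b := by
  refine squeeze_zero (fun E => Finset.sum_nonneg fun _ _ => dist_nonneg) (fun E => ?_)
    (by simpa using Tendsto.const_mul M hf)
  rw [Finset.mul_sum]
  exact Finset.sum_le_sum fun i _ => h _ _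

theorem _root_.AbsolutelyContinuousOnInterval.le_of_deriv_nonpos {f : ℝ → ℝ} {a b : ℝ}
    (hab : a ≤ b) (hf : AbsolutelyContinuousOnInterval f a b)
    (hd : ∀ᵐ t ∂(volume : Measure ℝ), a < t → t ≤ b → deriv f t ≤ 0) : f b ≤ f a := by
  have h1 := hf.integral_deriv_eq_sub
  have h2 : ∫ t in a..b, deriv f t ≤ 0 := by
    rw [intervalIntegral.integral_of_le hab]
    refine integral_nonpos_of_ae ?_
    filter_upwards [ae_restrict_of_ae hd, ae_restrict_mem measurableSet_Ioc] with t ht htm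
    exact ht htm.1 htm.2
  linarith

/-- A Grönwall inequality for absolutely continuous functions. -/
theorem _root_.AbsolutelyContinuousOnInterval.exp_mul_le_exp_mul {f : ℝ → ℝ} {a b c : ℝ}
    (hab : a ≤ b) (hf : AbsolutelyContinuousOnInterval f a b)
    (hd : ∀ᵐ t ∂(volume : Measure ℝ), a < t → t ≤ b →
      DifferentiableAt ℝ f t ∧ deriv f t ≤ -(c * f t)) :
    Real.exp (c * b) * f b ≤ Real.exp (c * a) * f a := by
  have hexp : ContDiff ℝ 1 fun t : ℝ => Real.exp (c * t) :=
    Real.contDiff_exp.comp (contDiff_const.mul contDiff_id)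
  refine AbsolutelyContinuousOnInterval.le_of_deriv_nonpos
    (f := fun t => Real.exp (c * t) * f t) hab
    (hexp.contDiffOn.absolutelyContinuousOnInterval.mul hf) ?_
  filter_upwards [hd] with t ht hat htb
  obtain ⟨hdiff, hle⟩ := ht hat htb
  have h1 : HasDerivAt (fun t : ℝ => Real.exp (c * t)) (Real.exp (c * t) * c) t := by
    simpa using ((hasDerivAt_id t).const_mul c).exp
  rw [(h1.fun_mul hdiff.hasDerivAt).deriv]
  nlinarith [Real.exp_pos (c * t)]

theorem _root_.HasDerivAt.le_of_eventually_le_right {f : ℝ → ℝ} {f' t k : ℝ}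
    (hf : HasDerivAt f f' t) (h : ∀ᶠ s in 𝓝[>] t, f s ≤ f t + (s - t) * k) : f' ≤ k := by
  have h1 : Tendsto (slope f t) (𝓝[>] t) (𝓝 f') :=
    (hasDerivAt_iff_tendsto_slope.1 hf).mono_left
      (nhdsWithin_mono _ fun s (hs : t < s) => hs.ne')
  refine le_of_tendsto h1 ?_
  filter_upwards [h, self_mem_nhdsWithin] with s hs hts
  have hts' : 0 < s - t := sub_pos.2 hts
  rw [slope_def_field, div_le_iff₀ hts']
  linarith

theorem _root_.HasDerivAt.hasDerivAt_norm_sub_affine {E : Type*} [NormedAddCommGroup E]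
    [NormedSpace ℝ E] {x : ℝ → E} {v : E} {t : ℝ} (hx : HasDerivAt x v t) :
    HasDerivAt (fun s => ‖x s - x t - (s - t) • v‖) 0 t := by
  rw [hasDerivAt_iff_isLittleO]
  simpa using hx.isLittleO.norm_left

/-- One-sided comparison of the derivative of `W` along a curve with the growth of `W` along the
tangent line. -/
theorem deriv_comp_le_of_tangent_le {W : EuclideanSpace ℝ (Fin n) → ℝ} {M : ℝ}
    (hlip : ∀ x y, |W x - W y| ≤ M * ‖x - y‖) {x : ℝ → EuclideanSpace ℝ (Fin n)}
    {v : EuclideanSpace ℝ (Fin n)} {t k σ : ℝ} (hx : HasDerivAt x v t) (hσ : |σ| = 1)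
    (hd : DifferentiableAt ℝ (fun s => W (x s)) t)
    (hk : ∀ᶠ s in 𝓝[>] 0, σ * W (x t + s • v) ≤ σ * W (x t) + s * k) :
    σ * deriv (fun s => W (x s)) t ≤ k := by
  -- Subtracting the tangent remainder leaves the derivative unchanged and, as `W` is Lipschitz,
  -- puts the function below `σ * W` on the tangent line.
  have h1 := (hd.hasDerivAt.const_mul σ).sub (hx.hasDerivAt_norm_sub_affine.const_mul M)
  rw [mul_zero, sub_zero] at h1
  refine h1.le_of_eventually_le_right ?_
  have htend : Tendsto (fun s => s - t) (𝓝[>] t) (𝓝[>] 0) := by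
    refine tendsto_nhdsWithin_iff.2 ⟨?_, ?_⟩
    · have : Tendsto (fun s => s - t) (𝓝 t) (𝓝 (t - t)) := (continuous_sub_right t).tendsto t
      rw [sub_self] at this
      exact this.mono_left nhdsWithin_le_nhds
    · filter_upwards [self_mem_nhdsWithin] with s hs
      exact sub_pos.2 (mem_Ioi.1 hs)
  filter_upwards [htend.eventually hk] with s hs
  have h2 : |σ * (W (x s) - W (x t + (s - t) • v))| ≤ M * ‖x s - x t - (s - t) • v‖ := by
    rw [abs_mul, hσ, one_mul, sub_sub]
    exact hlip _ _
  have h3 := (abs_le.1 h2).2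
  simp only [Pi.sub_apply, sub_self, zero_smul, norm_zero, mul_zero, sub_zero]
  linarith

/-! ### Lyapunov property and approximation -/

/-- A convex homogeneous function, equivalent to the norm, that contracts uniformly under Euler
steps of some fixed length is a common Lyapunov function. -/
theorem isCommonLyapunov_of_euler_step (hb : Bornology.IsBounded 𝓜)
    {W : EuclideanSpace ℝ (Fin n) → ℝ} (hW : W ∈ convexHomogeneous n) {m M h η : ℝ} (hm : 0 < m)
    (hh : 0 < h) (hη : 0 < η) (hlow : ∀ x, m * ‖x‖ ≤ W x) (hup : ∀ x, W x ≤ M * ‖x‖)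
    (hstep : ∀ B ∈ 𝓜, ∀ x, W (x + h • Matrix.toEuclideanLin B x) ≤ (1 - η) * W x) :
    IsCommonLyapunov 𝓜 W := by
  obtain ⟨K, hK, hbK⟩ := hb.exists_pos_norm_le
  have hlip : ∀ x y, |W x - W y| ≤ M * ‖x - y‖ := fun x y =>
    (convexHomogeneous.abs_sub_le hW x y).trans (hup _)
  have hlip' : ∀ x y, |W x - W y| ≤ |M| * ‖x - y‖ := fun x y =>
    (hlip x y).trans (by gcongr; exact le_abs_self M)
  have hcont : Continuous W := by
    refine (LipschitzWith.of_dist_le_mul (K := ⟨|M|, abs_nonneg M⟩) fun x y => ?_).continuous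
    rw [Real.dist_eq, dist_eq_norm]
    exact hlip' x y
  have hpos : ∀ x, x ≠ 0 → 0 < W x := fun x hx =>
    (mul_pos hm (norm_pos_iff.2 hx)).trans_le (hlow x)
  set c := η / h with hc
  have hc0 : 0 < c := by positivity
  -- Bounds the relative rate at which `W` can decrease, so a nonzero trajectory never reaches the
  -- origin; strictness needs this.
  set L := |M| * K / m with hL
  have key : ∀ A ∈ switchingLaws 𝓜, ∀ x : ℝ → EuclideanSpace ℝ (Fin n), IsTrajectory A x →
      ∀ a b, 0 ≤ a → a ≤ b → Real.exp (c * b) * W (x b) ≤ Real.exp (c * a) * W (x a) ∧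
        Real.exp (L * a) * W (x a) ≤ Real.exp (L * b) * W (x b) := by
    intro A hA x hx a b ha hab
    have hxac : AbsolutelyContinuousOnInterval x a b := by
      refine (hx.1 b (ha.trans hab)).mono ?_
      rw [uIcc_of_le hab, uIcc_of_le (ha.trans hab)]
      exact Icc_subset_Icc_left ha
    have hac : AbsolutelyContinuousOnInterval (fun s => W (x s)) a b :=
      hxac.of_dist_le (M := |M|) fun s t => by
        rw [Real.dist_eq, dist_eq_norm]; exact hlip' _ _
    have hder : ∀ᵐ t ∂(volume : Measure ℝ), a < t → t ≤ b →
        DifferentiableAt ℝ (fun s => W (x s)) t ∧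
          HasDerivAt x (Matrix.toEuclideanLin (A t) (x t)) t := by
      filter_upwards [hac.ae_differentiableAt, hx.2] with t h1 h2 hat htb
      refine ⟨h1 ?_, h2 (ha.trans_lt hat)⟩
      rw [uIcc_of_le hab]
      exact ⟨hat.le, htb⟩
    constructor
    · refine AbsolutelyContinuousOnInterval.exp_mul_le_exp_mul hab hac ?_
      filter_upwards [hder] with t ht hat htb
      obtain ⟨hd, hxd⟩ := ht hat htb
      refine ⟨hd, ?_⟩
      have := deriv_comp_le_of_tangent_le hlip hxd (σ := 1) (k := -(c * W (x t))) (by simp) hd ?_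
      · simpa using this
      filter_upwards [Ioo_mem_nhdsGT hh] with s hs
      have := convexHomogeneous.euler_step_le hW hh
        (hstep (A t) (hA.2 t (ha.trans hat.le)) (x t)) hs.1.le hs.2.le
      linarith
    · have hneg : AbsolutelyContinuousOnInterval (fun s => -W (x s)) a b := hac.neg
      have := AbsolutelyContinuousOnInterval.exp_mul_le_exp_mul (c := L) hab hneg ?_
      · linarith
      filter_upwards [hder] with t ht hat htb
      obtain ⟨hd, hxd⟩ := ht hat htb
      refine ⟨hd.neg, ?_⟩
      have hderiv : deriv (fun s => -W (x s)) t = (-1) * deriv (fun s => W (x s)) t := by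
        rw [hd.hasDerivAt.fun_neg.deriv]; ring
      rw [hderiv]
      refine deriv_comp_le_of_tangent_le hlip hxd (by simp) hd ?_
      filter_upwards [self_mem_nhdsWithin] with s hs
      have hs0 : 0 < s := hs
      set v := Matrix.toEuclideanLin (A t) (x t) with hv
      have h1 : |W (x t) - W (x t + s • v)| ≤ |M| * (s * ‖v‖) := by
        refine (hlip' _ _).trans (le_of_eq ?_)
        rw [sub_add_cancel_left, norm_neg, norm_smul, Real.norm_of_nonneg hs0.le]
      have h2 : |M| * (s * ‖v‖) ≤ s * (L * W (x t)) := by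
        calc |M| * (s * ‖v‖) ≤ |M| * (s * (K * ‖x t‖)) := by
              gcongr
              exact (norm_toEuclideanLin_le _ _).trans
                (by gcongr; exact hbK _ (hA.2 t (ha.trans hat.le)))
          _ = s * (L * (m * ‖x t‖)) := by rw [hL]; field_simp
          _ ≤ s * (L * W (x t)) := by gcongr; exact hlow _
      have h3 := (abs_le.1 h1).2
      linarith
  refine ⟨⟨hcont, convexHomogeneous.map_zero hW, hpos, fun A hA x hx a ha b hb hab => ?_⟩,
    fun A hA x hx hne a ha b hb hab => ?_⟩
  · have h1 := (key A hA x hx a b ha hab).1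
    have h2 : Real.exp (c * a) ≤ Real.exp (c * b) := Real.exp_le_exp.2 (by gcongr)
    exact le_of_mul_le_mul_left
      (h1.trans (mul_le_mul_of_nonneg_right h2 (hW.2.2 _))) (Real.exp_pos _)
  -- Decay carries positivity from `t` back to `0`; the lower bound carries it on to `a`.
  · obtain ⟨t, ht, hxt⟩ := hne
    have h0 : 0 < W (x 0) := by
      have h1 := (key A hA x hx 0 t le_rfl ht).1
      have h2 := mul_pos (Real.exp_pos (c * t)) (hpos _ hxt)
      simpa using h2.trans_le h1
    have ha0 : 0 < W (x a) := by
      have h1 := (key A hA x hx 0 a le_rfl ha).2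
      rw [mul_zero, Real.exp_zero, one_mul] at h1
      exact pos_of_mul_pos_right (h0.trans_le h1) (Real.exp_pos _).le
    have h1 := (key A hA x hx a b ha hab.le).1
    have h2 : Real.exp (c * a) < Real.exp (c * b) := Real.exp_lt_exp.2 (by gcongr)
    exact lt_of_mul_lt_mul_left (h1.trans_lt (mul_lt_mul_of_pos_right h2 ha0)) (Real.exp_pos _).le

end SwitchedSystem

theorem mainTheorem1 (n : ℕ) (P : Set (EuclideanSpace ℝ (Fin n) → ℝ))
    (hP : P ⊆ SwitchedSystem.convexHomogeneous n)
    (happrox : ∀ V ∈ SwitchedSystem.convexHomogeneous n, ∀ δ : ℝ, 0 < δ →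
      ∃ W ∈ P, ∀ x ∈ Metric.sphere (0 : EuclideanSpace ℝ (Fin n)) 1, |W x - V x| ≤ δ) :
    SwitchedSystem.IsUniversalClass P := by
  intro 𝓜 hb hs
  obtain ⟨V, hV, M, h, η, hh, hη, hη1, hlow, hup, hstep⟩ :=
    SwitchedSystem.exists_contracted_by_euler_step hb hs
  -- As `‖x‖ ≤ V x`, the error is at most `(η/2) V x`, which half of the contraction margin `2η`
  -- absorbs.
  obtain ⟨W, hWP, hWV⟩ := happrox V hV (η / 2) (by positivity)
  have hW := hP hWP
  have hclose := fun x => abs_le.1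
    (SwitchedSystem.convexHomogeneous.abs_sub_le_mul_norm hW hV hWV x)
  have hle : ∀ x, W x ≤ (1 + η / 2) * V x := fun x => by nlinarith [(hclose x).2, hlow x]
  have hge : ∀ x, (1 - η / 2) * V x ≤ W x := fun x => by nlinarith [(hclose x).1, hlow x]
  refine ⟨W, hWP, SwitchedSystem.isCommonLyapunov_of_euler_step hb hW (m := 1 / 2)
    (M := (1 + η / 2) * M) (by norm_num) hh hη (fun x => ?_) (fun x => ?_) fun B hB x => ?_⟩
  · nlinarith [hge x, hlow x, norm_nonneg x]
  · refine (hle x).trans ?_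
    rw [mul_assoc]
    gcongr
    exact hup x
  · calc W (x + h • Matrix.toEuclideanLin B x)
        ≤ (1 + η / 2) * V (x + h • Matrix.toEuclideanLin B x) := hle _
      _ ≤ (1 + η / 2) * ((1 - 2 * η) * V x) := by gcongr; exact hstep B hB x
      -- The two coefficients differ by `3η²/2`.
      _ ≤ (1 - η) * ((1 - η / 2) * V x) := by
        nlinarith [mul_nonneg (sq_nonneg η) (hV.2.2 x)]
      _ ≤ (1 - η) * W x := mul_le_mul_of_nonneg_left (hge x) (by linarith)
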